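/- Let $\mathsf A$ be an abelian category, let $Q=(Q_0,Q_1)$ be a quiver, and let $\mathsf L$ be a subcategory of $\mathsf A$, that is, a full additive subcategory closed under isomorphisms (it need not be closed under direct summands). Write $\mathrm{Rep}(Q,\mathsf A)$ for the abelian category of $\mathsf A$-valued representations of $Q$ and $s(a)$, $t(a)$ for the source and target of an arrow $a$. **Definitions.** Define subsets $V_\alpha\subseteq Q_0$, for ordinals $\alpha$, by $V_0=\emptyset$; $V_{\alpha+1}=\{i\in Q_0 \mid i \text{ is not the target of any arrow } a \text{ with } s(a)\notin\bigcup_{\beta\le\alpha}V_\beta\}$; and $V_\alpha=\bigcup_{\beta<\alpha}V_\beta$ for limit ordinals $\alpha$. The quiver $Q$ is *left rooted* if $V_\lambda=Q_0$ for some ordinal $\lambda$, and *right rooted* if the opposite quiver $Q^{\mathrm{op}}$ is left rooted. For a subcategory (or a class of objects closed under isomorphisms) $\mathsf X$ of an abelian category $\mathsf B$ put $\mathsf X^\perp=\{M\in\mathsf B \mid \mathrm{Ext}^1_{\mathsf B}(X,M)=0 \text{ for all } X\in\mathsf X\}$ and ${}^\perp\mathsf X=\{M\in\mathsf B\mid \mathrm{Ext}^1_{\mathsf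 B}(M,X)=0 \text{ for all } X\in\mathsf X\}$. Then $\mathsf X$ is *special precovering* in $\mathsf B$ if for every $M\in\mathsf B$ there is an epimorphism $f:X\to M$ with $X\in\mathsf X$ and $\mathrm{Ker} f\in\mathsf X^\perp$, and *special preenveloping* in $\mathsf B$ if for every $M\in\mathsf B$ there is a monomorphism $g:M\to X$ with $X\in\mathsf X$ and $\mathrm{Coker}\, g\in{}^\perp\mathsf X$. If $\mathsf A$ has small coproducts, then $\Phi(\mathsf L)$ denotes the class of all $X\in\mathrm{Rep}(Q,\mathsf A)$ such that for each vertex $i$ the canonical morphism $\varphi_i^X:\bigoplus_{a\in Q_1,\,t(a)=i}X(s(a))\to X(i)$ is a monomorphism with $\mathrm{Coker}\,\varphi_i^X\in\mathsf L$. If $\mathsf A$ has small products, then $\Psi(\mathsf L)$ denotes the class of all $X\in\mathrm{Rep}(Q,\mathsf A)$ such that for each vertex $i$ the canonical morphism $\psi_i^X:X(i)\to\prod_{a\in Q_1,\,s(a)=i}X(t(a))$ is an epimorphism with $\mathrm{Ker}\,\psi_i^X\in\mathsf L$. **Theorem B.** (a) Suppose that $Q$ is left rooted, and that $\mathsf A$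 satisfies the axiom AB4 (it has small coproducts, and coproducts of monomorphisms are monomorphisms) and has enough injectives. If $\mathsf L$ is special precovering in $\mathsf A$, then $\Phi(\mathsf L)$ is special precovering in $\mathrm{Rep}(Q,\mathsf A)$. (b) Suppose that $Q$ is right rooted, and that $\mathsf A$ satisfies the axiom AB4* (it has small products, and products of epimorphisms are epimorphisms) and has enough projectives. If $\mathsf L$ is special preenveloping in $\mathsf A$, then $\Psi(\mathsf L)$ is special preenveloping in $\mathrm{Rep}(Q,\mathsf A)$. -/

import Mathlib

open CategoryTheory CategoryTheory.Limits

universe w₀ w₁ v u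

namespace QuiverReps

section Rooted

variable (Q : Type w₀) [Quiver.{w₁} Q]

/-- The transfinite sequence `V_α` of sets of vertices of the quiver `Q`:
`V_0` is empty; a vertex belongs to `V_{β+1}` if it is not the target of any arrow whose source
lies outside `⋃_{γ ≤ β} V_γ`; and `V_α` is the union of the `V_β` with `β < α` if `α` is a limit
ordinal. -/
def rootSequence (α : Ordinal.{w₀}) : Set Q :=
  {i | (∃ β, ∃ _h : α = β + 1,
          ¬ ∃ (j : Q) (_ : j ⟶ i), ∀ γ, ∀ _hγ : γ ≤ β, j ∉ rootSequence γ) ∨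
       (Order.IsSuccLimit α ∧ ∃ β, ∃ _ : β < α, i ∈ rootSequence β)}
termination_by α
decreasing_by
  · subst _h
    exact lt_of_le_of_lt _hγ (Order.lt_succ β)
  · assumption

theorem rootSequence_zero : rootSequence Q 0 = ∅ := by
  ext i
  rw [rootSequence]
  simp only [Set.mem_ofPred_eq, Set.mem_empty_iff_false, iff_false, not_or]
  refine ⟨?_, fun h => h.1.1 isMin_bot⟩
  rintro ⟨β, h, -⟩
  exact (Order.succ_ne_bot β) h.symm

theorem rootSequence_add_one (β : Ordinal.{w₀}) :
    rootSequence Q (β + 1) =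
      {i | ¬ ∃ (j : Q) (_ : j ⟶ i), j ∉ ⋃ γ ≤ β, rootSequence Q γ} := by
  ext i
  rw [rootSequence]
  simp only [Set.mem_ofPred_eq, Set.mem_iUnion, not_exists]
  constructor
  · rintro (⟨β', h, H⟩ | ⟨h, -⟩)
    · obtain rfl : β = β' := Order.succ_injective h
      exact H
    · exact absurd h (Order.not_isSuccLimit_succ β)
  · intro H
    exact Or.inl ⟨β, rfl, H⟩

theorem rootSequence_limit (α : Ordinal.{w₀}) (hα : Order.IsSuccLimit α) :
    rootSequence Q α = ⋃ β < α, rootSequence Q β := by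
  ext i
  rw [rootSequence]
  simp only [Set.mem_ofPred_eq, Set.mem_iUnion]
  constructor
  · rintro (⟨β, rfl, -⟩ | ⟨-, H⟩)
    · exact absurd hα (Order.not_isSuccLimit_succ β)
    · exact H
  · intro H
    exact Or.inr ⟨hα, H⟩

/-- A quiver is left rooted if `V_α` is the set of all vertices for some ordinal `α`. -/
def IsLeftRooted : Prop := ∃ α : Ordinal.{w₀}, rootSequence Q α = Set.univ

/-- A quiver is right rooted if its opposite quiver is left rooted. -/
def IsRightRooted : Prop := IsLeftRooted Qᵒᵖ

end Rooted

section Approximations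

variable {C : Type u} [Category.{v} C] [Abelian C]

/-- `Ext¹(X, Y) = 0`. -/
def ExtOneVanishes (X Y : C) : Prop :=
  letI : HasExt.{max u v} C := HasExt.standard C
  Subsingleton (Abelian.Ext.{max u v} X Y 1)

/-- The class `L^⊥` of the objects `M` with `Ext¹(X, M) = 0` for all `X` in `L`. -/
def rightPerp (L : ObjectProperty C) : ObjectProperty C :=
  fun M => ∀ X : C, L X → ExtOneVanishes X M

/-- The class `^⊥L` of the objects `M` with `Ext¹(M, X) = 0` for all `X` in `L`. -/
def leftPerp (L : ObjectProperty C) : ObjectProperty C :=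
  fun M => ∀ X : C, L X → ExtOneVanishes M X

/-- `f : X ⟶ M` is a special `L`-precover of `M`. -/
def IsSpecialPrecover (L : ObjectProperty C) {X M : C} (f : X ⟶ M) : Prop :=
  Epi f ∧ L X ∧ rightPerp L (kernel f)

/-- `g : M ⟶ X` is a special `L`-preenvelope of `M`. -/
def IsSpecialPreenvelope (L : ObjectProperty C) {M X : C} (g : M ⟶ X) : Prop :=
  Mono g ∧ L X ∧ leftPerp L (cokernel g)

/-- Every object has a special `L`-precover. -/
def IsSpecialPrecovering (L : ObjectProperty C) : Prop :=
  ∀ M : C, ∃ (X : C) (f : X ⟶ M), IsSpecialPrecover L f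

/-- Every object has a special `L`-preenvelope. -/
def IsSpecialPreenveloping (L : ObjectProperty C) : Prop :=
  ∀ M : C, ∃ (X : C) (g : M ⟶ X), IsSpecialPreenvelope L g

end Approximations

section Representations

/-- The category of `A`-valued representations of the quiver `Q`: functors from the free category
on `Q` to `A`. -/
abbrev Representation (Q : Type w₀) [Quiver.{w₁} Q] (A : Type u) [Category.{v} A] :=
  Paths Q ⥤ A

variable {Q : Type w₀} [Quiver.{w₁} Q] {A : Type u} [Category.{v} A]

/-- The object `X(i)` of a representation `X` at the vertex `i`. -/
abbrev Representation.vertex (X : Representation Q A) (i : Q) : A :=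
  X.obj ((Paths.of Q).obj i)

/-- The morphism `X(a) : X(i) ⟶ X(j)` of a representation `X` at the arrow `a : i ⟶ j`. -/
abbrev Representation.arrow (X : Representation Q A) {i j : Q} (a : i ⟶ j) :
    Representation.vertex X i ⟶ Representation.vertex X j :=
  X.map ((Paths.of Q).map a)

/-- The canonical morphism from the coproduct of the `X(s(a))`, where `a` runs through the arrows
with target `i`, to `X(i)`. -/
noncomputable def phi [HasCoproducts.{max w₀ w₁} A] (X : Representation Q A) (i : Q) :
    (∐ fun a : Quiver.Costar i => Representation.vertex X a.1) ⟶ Representation.vertex X i :=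
  Sigma.desc fun a => Representation.arrow X a.2

/-- The canonical morphism from `X(i)` to the product of the `X(t(a))`, where `a` runs through the
arrows with source `i`. -/
noncomputable def psi [HasProducts.{max w₀ w₁} A] (X : Representation Q A) (i : Q) :
    Representation.vertex X i ⟶ ∏ᶜ fun a : Quiver.Star i => Representation.vertex X a.1 :=
  Pi.lift fun a => Representation.arrow X a.2

variable (Q) [Abelian A]

/-- `Φ(L)`: the representations `X` such that, for every vertex `i`, the morphism `φ_i^X` is a
monomorphism and its cokernel lies in `L`. -/
def Phi [HasCoproducts.{max w₀ w₁} A] (L : ObjectProperty A) :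
    ObjectProperty (Representation Q A) :=
  fun X => ∀ i : Q, Mono (phi X i) ∧ L (cokernel (phi X i))

/-- `Ψ(L)`: the representations `X` such that, for every vertex `i`, the morphism `ψ_i^X` is an
epimorphism and its kernel lies in `L`. -/
def Psi [HasProducts.{max w₀ w₁} A] (L : ObjectProperty A) :
    ObjectProperty (Representation Q A) :=
  fun X => ∀ i : Q, Epi (psi X i) ∧ L (kernel (psi X i))

end Representations

end QuiverReps

/-! In a left rooted quiver the relation "there is an arrow from `j` to `i`" is well founded, so
both a precover and the splittings of extensions can be built vertex by vertex. Over `M`, suppose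
`X(j) ⟶ M(j)` is known for all arrows `j ⟶ i`. Factor the induced map from the coproduct of the
`X(j)` to `M(i)` as a monomorphism with cokernel in `L` followed by an epimorphism with kernel in
`L^⊥` (`IsSpecialPrecovering.exists_factorization`). The first factor becomes `φ_i`, the second the
component of the precover at `i`.

The kernel `K` of the resulting map is vertexwise in `L^⊥`, which forces `Ext¹(Y, K) = 0` for `Y` in
`Φ(L)` (`Phi.extOneVanishes`). Indeed, sections already chosen at the sources of arrows into `i`
give a partial section on the domain of the monomorphism `φ_i`. It extends to `Y(i)` because
`Ext¹(coker φ_i, K(i)) = 0`. Vanishing of `Ext¹` is tested on splittings by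
`subsingleton_of_forall_retraction`. Part (b) is dual. -/

/-- The pushout of a short exact sequence along a morphism out of its first term. -/
lemma CategoryTheory.ShortComplex.ShortExact.pushout {C : Type u} [Category.{v} C] [Abelian C]
    {S : ShortComplex C} (hS : S.ShortExact) {Y : C} (f : S.X₁ ⟶ Y) :
    (ShortComplex.mk (pushout.inr S.f f)
      (pushout.desc S.g (0 : Y ⟶ S.X₃) (by rw [S.zero, comp_zero]))
      (pushout.inr_desc _ _ _)).ShortExact := by
  have := hS.mono_f
  have := hS.epi_g
  have hp : Epi (pushout.desc S.g (0 : Y ⟶ S.X₃) (by rw [S.zero, comp_zero] : S.f ≫ _ = f ≫ _)) :=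
    epi_of_epi_fac (pushout.inl_desc S.g 0 _)
  refine ShortComplex.ShortExact.mk' (ShortComplex.exact_of_g_is_cokernel _
    (CokernelCofork.IsColimit.ofπ' _ _ fun k hk ↦ ⟨hS.exact.desc (pushout.inl _ _ ≫ k) ?_, ?_⟩))
    inferInstance hp
  · rw [pushout.condition_assoc, hk, comp_zero]
  · apply pushout.hom_ext
    · rw [pushout.inl_desc_assoc, hS.exact.g_desc]
    · rw [pushout.inr_desc_assoc, zero_comp, hk]

/-! ### Vanishing of `Ext¹` from the splitting of extensions. -/

namespace CategoryTheory.Abelian.Ext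

open _root_.DerivedCategory HomologicalComplex

universe w

variable {C : Type u} [Category.{v} C] [Abelian C]

/-- A quasi-isomorphism from a complex in nonpositive degrees to an object in degree zero is an
epimorphism in degree zero. -/
lemma epi_f_zero_of_quasiIso {X : C} {K : CochainComplex C ℤ} [K.IsStrictlyLE 0]
    (s : K ⟶ (CochainComplex.singleFunctor C 0).obj X) [QuasiIso s] : Epi (s.f 0) := by
  let T : CochainComplex C ℤ := (CochainComplex.singleFunctor C 0).obj X
  have hπ : IsIso (T.homologyπ 0) :=
    T.isIso_homologyπ (-1) 0 (by simp) rfl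
  have hι : IsIso (T.iCycles 0) :=
    T.isIso_iCycles 0 1 (by simp) rfl
  have h : Epi (cyclesMap s 0 ≫ T.homologyπ 0) := by
    rw [← homologyπ_naturality]
    exact epi_comp _ _
  have h' : Epi (cyclesMap s 0) := by
    have : cyclesMap s 0 = (cyclesMap s 0 ≫ T.homologyπ 0) ≫ inv (T.homologyπ 0) := by simp
    rw [this]
    exact epi_comp _ _
  have h'' : Epi (K.iCycles 0 ≫ s.f 0) := by
    rw [← cyclesMap_i]
    exact epi_comp _ _
  exact epi_of_epi (K.iCycles 0) (s.f 0)

/-- Every class of positive degree vanishes after pulling back along a suitable epimorphism. -/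
lemma exists_epi_mk₀_comp_eq_zero [HasExt.{w} C] {X Y : C} {n : ℕ} (e : Ext X Y (n + 1)) :
    ∃ (P : C) (p : P ⟶ X), Epi p ∧ (mk₀ p).comp e (zero_add _) = 0 := by
  let := HasDerivedCategory.standard C
  -- The class becomes a roof `X ⟵ K ⟶ Y[n+1]` with `K` in degrees at most 0; the epimorphism sought
  -- is the degree-zero part of `s`.
  obtain ⟨K, _, s, hs, g, hg⟩ := right_fac_of_isStrictlyLE
    (X := (CochainComplex.singleFunctor C 0).obj X)
    (Y := (CochainComplex.singleFunctor C (-(n + 1))).obj Y)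
    (e.hom ≫ ((singleFunctors C).shiftIso (n + 1) (-(n + 1)) 0 (by lia)).hom.app _) 0
  rw [isIso_Q_map_iff_quasiIso] at hs
  have := epi_f_zero_of_quasiIso s
  let p : K.X 0 ⟶ X := s.f 0
  let j : (CochainComplex.singleFunctor C 0).obj (K.X 0) ⟶ K :=
    mkHomFromSingle (𝟙 _) fun i hi ↦
      (K.isZero_of_isStrictlyLE 0 i (by simp at hi; lia)).eq_of_tgt _ _
  have hj : j ≫ s = (CochainComplex.singleFunctor C 0).map p := by
    apply from_single_hom_ext
    rw [comp_f, mkHomFromSingle_f, Category.comp_id]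
    refine Eq.trans ?_ (single_map_f_self _ 0 p).symm
    exact congrArg (_ ≫ ·) (Category.comp_id (s.f 0)).symm
  -- The target of `g` is concentrated in degree `-(n+1) < 0`, while `j` starts in degree 0.
  have hjg : j ≫ g = 0 := by
    apply from_single_hom_ext
    apply (CochainComplex.isZero_of_isStrictlyLE _ (-(n + 1 : ℤ)) 0 (by lia)).eq_of_tgt
  refine ⟨K.X 0, p, inferInstanceAs (Epi (s.f 0)), ?_⟩
  refine Ext.ext ?_
  rw [comp_hom, mk₀_hom, ShiftedHom.mk₀_comp, ← cancel_mono (((singleFunctors C).shiftIso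
    (n + 1) (-(n + 1)) 0 (by lia)).hom.app _)]
  have hp : (singleFunctor C 0).map p = Q.map j ≫ Q.map s := by
    rw [← Q.map_comp, hj]
    rfl
  rw [zero_hom, Limits.zero_comp, Category.assoc]
  refine (congrArg (_ ≫ ·) hg).trans ?_
  refine (congrArg (· ≫ _) hp).trans ?_
  have hz : (Q.map j ≫ Q.map s) ≫ inv (Q.map s) ≫ Q.map g = 0 := by
    rw [Category.assoc, IsIso.hom_inv_id_assoc, ← Q.map_comp, hjg, Q.map_zero]
  exact hz

/-- If every extension of `X` by `Y` splits, then `Ext¹(X, Y)` vanishes. -/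
lemma subsingleton_of_forall_retraction [HasExt.{w} C] {X Y : C}
    (h : ∀ (E : C) (i : Y ⟶ E) (p : E ⟶ X) (w : i ≫ p = 0),
      (ShortComplex.mk i p w).ShortExact → ∃ r : E ⟶ Y, i ≫ r = 𝟙 Y) :
    Subsingleton (Ext.{w} X Y 1) := by
  refine subsingleton_of_forall_eq 0 fun e ↦ ?_
  obtain ⟨P, p, hp, hpe⟩ := exists_epi_mk₀_comp_eq_zero e
  let S := ShortComplex.mk (kernel.ι p) p (by simp)
  have hS : S.ShortExact := .mk' (ShortComplex.exact_kernel p) inferInstance hp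
  -- Since `e` dies on `P`, it is the pushout of `0 ⟶ ker p ⟶ P ⟶ X ⟶ 0` along some `f : ker p ⟶ Y`.
  -- A retraction of that pushout extends `f` to `P`, so `e = 0`.
  obtain ⟨x, rfl⟩ := contravariant_sequence_exact₃ hS Y e hpe (n₀ := 0) (add_zero 1)
  obtain ⟨f, rfl⟩ := (mk₀_bijective _ _).2 x
  obtain ⟨r, hr⟩ := h _ _ _ _ (hS.pushout f)
  have hf : S.f ≫ pushout.inl S.f f ≫ r = f := by
    rw [pushout.condition_assoc, hr, Category.comp_id]
  rw [← hf, ← mk₀_comp_mk₀, ShortComplex.ShortExact.extClass_comp_assoc]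

end CategoryTheory.Abelian.Ext

/-! ### Kernel and cokernel sequences; extending partial splittings. -/

namespace CategoryTheory

variable {C : Type u} [Category.{v} C] [Abelian C]

namespace ShortComplex.ShortExact

/-- The pullback of a short exact sequence along a morphism to its last term. -/
lemma pullback {S : ShortComplex C} (hS : S.ShortExact) {Y : C} (f : Y ⟶ S.X₃) :
    (ShortComplex.mk (pullback.lift S.f (0 : S.X₁ ⟶ Y) (by rw [S.zero, zero_comp]))
      (pullback.snd S.g f) (pullback.lift_snd _ _ _)).ShortExact := by
  have := hS.mono_f
  have := hS.epi_g
  have hp : Mono (pullback.lift S.f (0 : S.X₁ ⟶ Y)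
      (by rw [S.zero, zero_comp] : _ ≫ S.g = _ ≫ f)) :=
    mono_of_mono_fac (pullback.lift_fst S.f 0 _)
  refine ShortComplex.ShortExact.mk' (ShortComplex.exact_of_f_is_kernel _
    (KernelFork.IsLimit.ofι' _ _ fun k hk ↦ ⟨hS.exact.lift (k ≫ pullback.fst _ _) ?_, ?_⟩))
    hp inferInstance
  · rw [Category.assoc, pullback.condition, reassoc_of% hk, zero_comp]
  · apply pullback.hom_ext
    · rw [Category.assoc, pullback.lift_fst, hS.exact.lift_f]
    · rw [Category.assoc, pullback.lift_snd, comp_zero, hk]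

end ShortComplex.ShortExact

/-- The short exact sequence `0 ⟶ ker f ⟶ ker (f ≫ g) ⟶ ker g ⟶ 0` for an epimorphism `f`. -/
lemma shortExact_kernel_comp {X Y Z : C} (f : X ⟶ Y) (g : Y ⟶ Z) [Epi f] :
    (ShortComplex.mk (kernel.map f (f ≫ g) (𝟙 _) g (by simp))
      (kernel.map (f ≫ g) g f (𝟙 _) (by simp)) (by ext; simp)).ShortExact := by
  have h := kernelCokernelCompSequence_exact f g
  have h₁ := h.exact 1
  exact .mk' (h.exact 0) inferInstance
    (h₁.epi_f ((isZero_cokernel_of_epi f).eq_of_tgt _ _))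

/-- The short exact sequence `0 ⟶ coker f ⟶ coker (f ≫ g) ⟶ coker g ⟶ 0` for a
monomorphism `g`. -/
lemma shortExact_cokernel_comp {X Y Z : C} (f : X ⟶ Y) (g : Y ⟶ Z) [Mono g] :
    (ShortComplex.mk (cokernel.map f (f ≫ g) (𝟙 _) g (by simp))
      (cokernel.map (f ≫ g) g f (𝟙 _) (by simp)) (by ext; simp)).ShortExact := by
  have h := kernelCokernelCompSequence_exact f g
  have h₂ := h.exact 2
  exact .mk' (h.exact 3) (h₂.mono_g ((isZero_kernel_of_mono g).eq_of_src _ _)) inferInstance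

namespace Abelian.Ext

universe w

variable [HasExt.{w} C]

/-- If `Ext¹(coker u, X₁) = 0` for a monomorphism `u : U ⟶ X₃`, then every partial section of a
short exact sequence which is defined on `U` extends to a section. -/
lemma exists_section_extending {S : ShortComplex C} (hS : S.ShortExact) {U : C} (u : U ⟶ S.X₃)
    [Mono u] (h : Subsingleton (Ext.{w} (cokernel u) S.X₁ 1)) (t : U ⟶ S.X₂) (ht : t ≫ S.g = u) :
    ∃ s : S.X₃ ⟶ S.X₂, s ≫ S.g = 𝟙 _ ∧ u ≫ s = t := by
  let T := ShortComplex.mk u (cokernel.π u) (by simp)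
  have hT : T.ShortExact := .mk' (ShortComplex.exact_cokernel u) inferInstance inferInstance
  -- The class vanishes on `U`, where `t` is a section, and so comes from `Ext¹(coker u, X₁) = 0`.
  have he : hS.extClass = 0 := by
    obtain ⟨x, hx⟩ := contravariant_sequence_exact₂ hT S.X₁ hS.extClass (by
      rw [show T.f = t ≫ S.g from ht.symm, ← mk₀_comp_mk₀, comp_assoc_of_second_deg_zero,
        hS.comp_extClass, comp_zero])
    rw [← hx, h.elim x 0, comp_zero]
  obtain ⟨y, hy⟩ := covariant_sequence_exact₃ S.X₃ hS (mk₀ (𝟙 _)) (zero_add 1)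
    (by rw [he, comp_zero])
  obtain ⟨s₀, rfl⟩ := (mk₀_bijective _ _).2 y
  rw [mk₀_comp_mk₀] at hy
  have hs₀ : s₀ ≫ S.g = 𝟙 _ := (mk₀_bijective _ _).1 hy
  -- The error of an arbitrary section `s₀` on `U` takes values in `X₁`; it extends along `u` by the
  -- same vanishing and is then added to `s₀`.
  have hd : (t - u ≫ s₀) ≫ S.g = 0 := by simp [ht, hs₀]
  have := hS.mono_f
  obtain ⟨z, hz⟩ := contravariant_sequence_exact₁ hT S.X₁ (mk₀ (hS.exact.lift _ hd)) (add_zero 1)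
    (h.elim _ _)
  obtain ⟨d, rfl⟩ := (mk₀_bijective _ _).2 z
  rw [mk₀_comp_mk₀] at hz
  have hd' : u ≫ d = hS.exact.lift _ hd := (mk₀_bijective _ _).1 hz
  refine ⟨s₀ + d ≫ S.f, by simp [hs₀], ?_⟩
  rw [Preadditive.comp_add, reassoc_of% hd', hS.exact.lift_f]
  abel

/-- If `Ext¹(X₃, ker u) = 0` for an epimorphism `u : X₁ ⟶ U`, then every partial retraction of a
short exact sequence with values in `U` lifts to a retraction. -/
lemma exists_retraction_lifting {S : ShortComplex C} (hS : S.ShortExact) {U : C} (u : S.X₁ ⟶ U)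
    [Epi u] (h : Subsingleton (Ext.{w} S.X₃ (kernel u) 1)) (t : S.X₂ ⟶ U) (ht : S.f ≫ t = u) :
    ∃ r : S.X₂ ⟶ S.X₁, S.f ≫ r = 𝟙 _ ∧ r ≫ u = t := by
  let T := ShortComplex.mk (kernel.ι u) u (by simp)
  have hT : T.ShortExact := .mk' (ShortComplex.exact_kernel u) inferInstance inferInstance
  have he : hS.extClass = 0 := by
    obtain ⟨x, hx⟩ := covariant_sequence_exact₂ S.X₃ hT hS.extClass (by
      rw [show T.g = S.f ≫ t from ht.symm, ← mk₀_comp_mk₀, ← comp_assoc_of_second_deg_zero,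
        hS.extClass_comp, zero_comp])
    rw [← hx, h.elim x 0, zero_comp]
  obtain ⟨y, hy⟩ := contravariant_sequence_exact₁ hS S.X₁ (mk₀ (𝟙 _)) (add_zero 1)
    (by rw [he, zero_comp])
  obtain ⟨r₀, rfl⟩ := (mk₀_bijective _ _).2 y
  rw [mk₀_comp_mk₀] at hy
  have hr₀ : S.f ≫ r₀ = 𝟙 _ := (mk₀_bijective _ _).1 hy
  have hd : S.f ≫ (t - r₀ ≫ u) = 0 := by simp [ht, reassoc_of% hr₀]
  have := hS.epi_g
  obtain ⟨z, hz⟩ := covariant_sequence_exact₃ S.X₃ hT (mk₀ (hS.exact.desc _ hd)) (zero_add 1)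
    (h.elim _ _)
  obtain ⟨d, rfl⟩ := (mk₀_bijective _ _).2 z
  rw [mk₀_comp_mk₀] at hz
  have hd' : d ≫ u = hS.exact.desc _ hd := (mk₀_bijective _ _).1 hz
  refine ⟨r₀ + S.g ≫ d, by simp [hr₀], ?_⟩
  rw [Preadditive.add_comp, Category.assoc, hd', hS.exact.g_desc]
  abel

lemma subsingleton_of_shortExact_right {S : ShortComplex C} (hS : S.ShortExact) {X : C} {n : ℕ}
    (h₁ : Subsingleton (Ext.{w} X S.X₁ n)) (h₃ : Subsingleton (Ext.{w} X S.X₃ n)) :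
    Subsingleton (Ext.{w} X S.X₂ n) := by
  refine subsingleton_of_forall_eq 0 fun x ↦ ?_
  obtain ⟨y, rfl⟩ := covariant_sequence_exact₂ X hS x (h₃.elim _ _)
  rw [h₁.elim y 0, zero_comp]

lemma subsingleton_of_shortExact_left {S : ShortComplex C} (hS : S.ShortExact) {Y : C} {n : ℕ}
    (h₁ : Subsingleton (Ext.{w} S.X₁ Y n)) (h₃ : Subsingleton (Ext.{w} S.X₃ Y n)) :
    Subsingleton (Ext.{w} S.X₂ Y n) := by
  refine subsingleton_of_forall_eq 0 fun x ↦ ?_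
  obtain ⟨y, rfl⟩ := contravariant_sequence_exact₂ hS Y x (h₁.elim _ _)
  rw [h₃.elim y 0, comp_zero]

lemma subsingleton_of_iso_right {X Y Y' : C} {n : ℕ} (e : Y ≅ Y')
    (h : Subsingleton (Ext.{w} X Y n)) : Subsingleton (Ext.{w} X Y' n) := by
  refine subsingleton_of_forall_eq 0 fun x ↦ ?_
  have : (x.comp (mk₀ e.inv) (add_zero n)).comp (mk₀ e.hom) (add_zero n) = x := by simp
  rw [← this, h.elim (x.comp _ _) 0, zero_comp]

lemma subsingleton_of_iso_left {X X' Y : C} {n : ℕ} (e : X ≅ X')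
    (h : Subsingleton (Ext.{w} X Y n)) : Subsingleton (Ext.{w} X' Y n) := by
  refine subsingleton_of_forall_eq 0 fun x ↦ ?_
  have : (mk₀ e.inv).comp ((mk₀ e.hom).comp x (zero_add n)) (zero_add n) = x := by simp
  rw [← this, h.elim ((mk₀ e.hom).comp _ _) 0, comp_zero]

end CategoryTheory.Abelian.Ext

/-! ### Factorizations obtained from special approximations. -/

namespace QuiverReps

variable {C : Type u} [Category.{v} C] [Abelian C]

/-- Every morphism `m : S ⟶ M` factors as a monomorphism with cokernel in `L` followed by an
epimorphism with kernel in `L^⊥`. -/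
lemma IsSpecialPrecovering.exists_factorization [EnoughInjectives C] {L : ObjectProperty C}
    [L.IsClosedUnderIsomorphisms] (hL : IsSpecialPrecovering L) {S M : C} (m : S ⟶ M) :
    ∃ (X : C) (g : S ⟶ X) (f : X ⟶ M), g ≫ f = m ∧ (Mono g ∧ L (cokernel g)) ∧
      Epi f ∧ rightPerp L (kernel f) := by
  -- The injective summand makes `m` a monomorphism. Pulling back a special precover of `coker b`
  -- then gives an extension of an object of `L` by `S`.
  let b : S ⟶ M ⊞ Injective.under S := biprod.lift m (Injective.ι S)
  have hb : Mono b := mono_of_mono_fac (biprod.lift_snd m (Injective.ι S))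
  obtain ⟨Y, q, hq, hY, hK⟩ := hL (cokernel b)
  have hT : (ShortComplex.mk b (cokernel.π b) (by simp)).ShortExact :=
    .mk' (ShortComplex.exact_cokernel b) inferInstance inferInstance
  have hT' := hT.pullback q
  have := hT'.mono_f
  have := isIso_kernel_map_of_isPullback (IsPullback.of_hasPullback (cokernel.π b) q)
  refine ⟨pullback (cokernel.π b) q, _, pullback.fst _ _ ≫ biprod.fst, ?_,
    ⟨hT'.mono_f, L.prop_of_iso (hT'.gIsCokernel.coconePointUniqueUpToIso
      (colimit.isColimit _)) hY⟩, inferInstance, fun Z hZ ↦ ?_⟩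
  · rw [pullback.lift_fst_assoc, biprod.lift_fst]
  · let : HasExt.{max u v} C := HasExt.standard C
    have e : kernel (biprod.fst : M ⊞ Injective.under S ⟶ M) ≅ Injective.under S :=
      (limit.isLimit _).conePointUniqueUpToIso (biprod.isKernelFstKernelFork M _)
    -- The kernel of the composite to `M` is an extension of the injective object by `ker q`, and
    -- both have vanishing `Ext¹` from `L`.
    refine Abelian.Ext.subsingleton_of_shortExact_right
      (shortExact_kernel_comp (pullback.fst (cokernel.π b) q) biprod.fst)
      (Abelian.Ext.subsingleton_of_iso_right
        (asIso (kernel.map _ _ _ _ pullback.condition)).symm (hK Z hZ))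
      (Abelian.Ext.subsingleton_of_iso_right e.symm
        (Abelian.Ext.subsingleton_of_injective _ _ 0))

/-- Every morphism `m : M ⟶ S` factors as a monomorphism with cokernel in `^⊥L` followed by an
epimorphism with kernel in `L`. -/
lemma IsSpecialPreenveloping.exists_factorization [EnoughProjectives C] {L : ObjectProperty C}
    [L.IsClosedUnderIsomorphisms] (hL : IsSpecialPreenveloping L) {S M : C} (m : M ⟶ S) :
    ∃ (X : C) (f : M ⟶ X) (g : X ⟶ S), f ≫ g = m ∧ (Epi g ∧ L (kernel g)) ∧
      Mono f ∧ leftPerp L (cokernel f) := by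
  let b : M ⊞ Projective.over S ⟶ S := biprod.desc m (Projective.π S)
  have hb : Epi b := epi_of_epi_fac (biprod.inr_desc m (Projective.π S))
  obtain ⟨Y, q, hq, hY, hK⟩ := hL (kernel b)
  have hT : (ShortComplex.mk (kernel.ι b) b (by simp)).ShortExact :=
    .mk' (ShortComplex.exact_kernel b) inferInstance inferInstance
  have hT' := hT.pushout q
  have := hT'.epi_g
  have := isIso_cokernel_map_of_isPushout (IsPushout.of_hasPushout (kernel.ι b) q).flip
  refine ⟨pushout (kernel.ι b) q, biprod.inl ≫ pushout.inl _ _, _, ?_,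
    ⟨hT'.epi_g, L.prop_of_iso (hT'.fIsKernel.conePointUniqueUpToIso
      (limit.isLimit _)) hY⟩, inferInstance, fun Z hZ ↦ ?_⟩
  · rw [Category.assoc, pushout.inl_desc, biprod.inl_desc]
  · let : HasExt.{max u v} C := HasExt.standard C
    have e : cokernel (biprod.inl : M ⟶ M ⊞ Projective.over S) ≅ Projective.over S :=
      (colimit.isColimit _).coconePointUniqueUpToIso (biprod.isCokernelInlCokernelFork M _)
    -- The cokernel of the composite from `M` is an extension of `coker q` by the projective object.
    refine Abelian.Ext.subsingleton_of_shortExact_left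
      (shortExact_cokernel_comp biprod.inl (pushout.inl (kernel.ι b) q))
      (Abelian.Ext.subsingleton_of_iso_left e.symm
        (Abelian.Ext.subsingleton_of_projective _ _ 0))
      (Abelian.Ext.subsingleton_of_iso_left
        (asIso (cokernel.map _ _ _ _ pushout.condition.symm)) (hK Z hZ))

end QuiverReps

/-! ### Well-founded recursion and rooted quivers. -/

/-- Dependent families may be constructed by recursion along a well-founded relation when each
value only has to satisfy a predicate involving the values at smaller points. -/
lemma WellFounded.exists_family {α : Type*} {r : α → α → Prop} (hr : WellFounded r)
    {P : α → Type*} (R : ∀ i, P i → (∀ j, r j i → P j) → Prop)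
    (h : ∀ i (x : ∀ j, r j i → P j), ∃ d, R i d x) :
    ∃ D : ∀ i, P i, ∀ i, R i (D i) fun j _ ↦ D j := by
  choose F hF using h
  refine ⟨hr.fix F, fun i ↦ ?_⟩
  rw [hr.fix_eq F i]
  exact hF i _

namespace QuiverReps

section Rooted

variable {Q : Type w₀} [Quiver.{w₁} Q]

lemma acc_of_mem_rootSequence (α : Ordinal.{w₀}) :
    ∀ i ∈ rootSequence Q α, Acc (fun j i : Q ↦ Nonempty (j ⟶ i)) i := by
  induction α using WellFoundedLT.induction with
  | ind α ih =>
    intro i hi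
    rw [rootSequence] at hi
    rcases hi with ⟨β, rfl, hi⟩ | ⟨-, β, hβ, hi⟩
    · refine ⟨_, fun j ⟨a⟩ ↦ ?_⟩
      by_contra hj
      exact hi ⟨j, a, fun γ hγ hjγ ↦ hj (ih γ (Order.lt_succ_iff.2 hγ) j hjγ)⟩
    · exact ih β hβ i hi

lemma IsLeftRooted.wellFounded (hQ : IsLeftRooted Q) :
    WellFounded fun j i : Q ↦ Nonempty (j ⟶ i) := by
  obtain ⟨α, hα⟩ := hQ
  exact ⟨fun i ↦ acc_of_mem_rootSequence α i (hα ▸ Set.mem_univ i)⟩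

lemma IsRightRooted.wellFounded (hQ : IsRightRooted Q) :
    WellFounded fun j i : Q ↦ Nonempty (i ⟶ j) :=
  Subrelation.wf (r := InvImage (fun j i : Qᵒᵖ ↦ Nonempty (j ⟶ i)) Opposite.op)
    (fun {_ _} ⟨a⟩ ↦ ⟨a.op⟩) (InvImage.wf _ (IsLeftRooted.wellFounded hQ))

end Rooted

/-! ### Splitting criteria for `ExtOneVanishes`. -/

section Extensions

variable {C : Type u} [Category.{v} C] [Abelian C]

/-- A section `s` yields a retraction, since `1 - p ≫ s` is killed by `p` and so factors through
`i`. -/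
lemma ExtOneVanishes.of_forall_section {X Y : C}
    (h : ∀ (E : C) (i : Y ⟶ E) (p : E ⟶ X) (w : i ≫ p = 0),
      (ShortComplex.mk i p w).ShortExact → ∃ s : X ⟶ E, s ≫ p = 𝟙 X) :
    ExtOneVanishes X Y := by
  let : HasExt.{max u v} C := HasExt.standard C
  refine Abelian.Ext.subsingleton_of_forall_retraction fun E i p w hS ↦ ?_
  obtain ⟨s, hs⟩ := h E i p w hS
  have hr : (𝟙 E - p ≫ s) ≫ p = 0 := by simp [hs]
  have : Mono i := hS.mono_f
  refine ⟨hS.exact.lift _ hr, ?_⟩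
  rw [← cancel_mono i, Category.assoc]
  refine (congrArg (i ≫ ·) (hS.exact.lift_f _ hr)).trans ?_
  simp [reassoc_of% w]

lemma ExtOneVanishes.of_forall_retraction {X Y : C}
    (h : ∀ (E : C) (i : Y ⟶ E) (p : E ⟶ X) (w : i ≫ p = 0),
      (ShortComplex.mk i p w).ShortExact → ∃ r : E ⟶ Y, i ≫ r = 𝟙 Y) :
    ExtOneVanishes X Y :=
  let : HasExt.{max u v} C := HasExt.standard C
  Abelian.Ext.subsingleton_of_forall_retraction h

lemma rightPerp.of_iso {L : ObjectProperty C} {Y Y' : C} (h : rightPerp L Y) (e : Y ≅ Y') :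
    rightPerp L Y' :=
  let : HasExt.{max u v} C := HasExt.standard C
  fun X hX ↦ Abelian.Ext.subsingleton_of_iso_right e (h X hX)

lemma leftPerp.of_iso {L : ObjectProperty C} {X X' : C} (h : leftPerp L X) (e : X ≅ X') :
    leftPerp L X' :=
  let : HasExt.{max u v} C := HasExt.standard C
  fun Y hY ↦ Abelian.Ext.subsingleton_of_iso_left e (h Y hY)

lemma ExtOneVanishes.exists_section_extending {X E Y U : C} {i : Y ⟶ E} {p : E ⟶ X}
    {w : i ≫ p = 0} (hS : (ShortComplex.mk i p w).ShortExact) (u : U ⟶ X) [Mono u]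
    (h : ExtOneVanishes (cokernel u) Y) (t : U ⟶ E) (ht : t ≫ p = u) :
    ∃ s : X ⟶ E, s ≫ p = 𝟙 X ∧ u ≫ s = t :=
  let : HasExt.{max u v} C := HasExt.standard C
  Abelian.Ext.exists_section_extending hS u h t ht

lemma ExtOneVanishes.exists_retraction_lifting {X E Y U : C} {i : Y ⟶ E} {p : E ⟶ X}
    {w : i ≫ p = 0} (hS : (ShortComplex.mk i p w).ShortExact) (u : Y ⟶ U) [Epi u]
    (h : ExtOneVanishes X (kernel u)) (t : E ⟶ U) (ht : i ≫ t = u) :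
    ∃ r : E ⟶ Y, i ≫ r = 𝟙 Y ∧ r ≫ u = t :=
  let : HasExt.{max u v} C := HasExt.standard C
  Abelian.Ext.exists_retraction_lifting hS u h t ht

end Extensions

/-! ### Orthogonality and approximations for representations. -/

section Representations

variable {Q : Type w₀} [Quiver.{w₁} Q] {A : Type u} [Category.{v} A]

/-- The representation with given objects at the vertices and given morphisms at the arrows. -/
def Representation.mk (X : Q → A) (x : ∀ {i j : Q}, (i ⟶ j) → (X i ⟶ X j)) : Representation Q A :=
  Paths.lift { obj := X, map := x }

@[simp]
lemma Representation.mk_arrow (X : Q → A) (x : ∀ {i j : Q}, (i ⟶ j) → (X i ⟶ X j)) {i j : Q}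
    (a : i ⟶ j) : (Representation.mk X x).arrow a = x a :=
  Paths.lift_toPath _ a

/-- Morphisms of representations are given by their components at the vertices. -/
def Representation.homMk {X Y : Representation Q A} (f : ∀ i, X.vertex i ⟶ Y.vertex i)
    (hf : ∀ {i j : Q} (a : i ⟶ j), X.arrow a ≫ f j = f i ≫ Y.arrow a) : X ⟶ Y :=
  Paths.liftNatTrans f hf

lemma Representation.homMk_app {X Y : Representation Q A} (f : ∀ i, X.vertex i ⟶ Y.vertex i)
    (hf : ∀ {i j : Q} (a : i ⟶ j), X.arrow a ≫ f j = f i ≫ Y.arrow a) (i : Paths Q) :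
    (Representation.homMk f hf).app i = f i :=
  rfl

variable [Abelian A]

lemma Representation.shortExact_vertex {X Y Z : Representation Q A} {f : X ⟶ Y} {g : Y ⟶ Z}
    {w : f ≫ g = 0} (hS : (ShortComplex.mk f g w).ShortExact) (i : Q) :
    (ShortComplex.mk (X₁ := X.vertex i) (X₂ := Y.vertex i) (X₃ := Z.vertex i)
      (f.app _) (g.app _) (congr_app w _)).ShortExact :=
  hS.map_of_exact ((evaluation (Paths Q) A).obj ((Paths.of Q).obj i))

/-- `Ext¹(X, K)` vanishes if `X` lies in `Φ(L)` and `K` is vertexwise in `L^⊥`. -/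
lemma Phi.extOneVanishes [HasCoproducts.{max w₀ w₁} A] (hQ : IsLeftRooted Q)
    {L : ObjectProperty A} {X K : Representation Q A} (hX : Phi Q L X)
    (hK : ∀ i, rightPerp L (K.vertex i)) :
    ExtOneVanishes X K := by
  refine .of_forall_section fun E ι p w hS ↦ ?_
  obtain ⟨s, hs⟩ := hQ.wellFounded.exists_family
    (P := fun i ↦ {s : X.vertex i ⟶ E.vertex i // s ≫ p.app ((Paths.of Q).obj i) = 𝟙 _})
    -- Compatibility with the arrows into `i` prescribes the section on the image of `φ_i`, and this
    -- is all that naturality requires.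
    (fun i s s' ↦ ∀ j (a : j ⟶ i), X.arrow a ≫ s.1 = (s' j ⟨a⟩).1 ≫ E.arrow a)
    (fun i s' ↦ by
      have hSi := Representation.shortExact_vertex hS i
      have := (hX i).1
      obtain ⟨s, hs, hs'⟩ := ExtOneVanishes.exists_section_extending hSi (phi X i)
        (hK i _ (hX i).2) (Sigma.desc fun a ↦ (s' a.1 ⟨a.2⟩).1 ≫ E.arrow a.2) (by
          apply Sigma.hom_ext
          intro a
          have h₁ :
              E.arrow a.2 ≫ p.app ((Paths.of Q).obj i) = p.app ((Paths.of Q).obj a.1) ≫ X.arrow a.2 :=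
            p.naturality _
          have h₂ := (s' a.1 ⟨a.2⟩).2
          simp [phi, h₁, reassoc_of% h₂])
      refine ⟨⟨s, hs⟩, fun j a ↦ ?_⟩
      simpa [phi] using Sigma.ι (fun a : Quiver.Costar i ↦ X.vertex a.1) (.mk a) ≫= hs')
  refine ⟨Representation.homMk (fun i ↦ (s i).1) fun a ↦ hs _ _ a, ?_⟩
  ext i
  exact (s i).2

/-- `Ext¹(K, X)` vanishes if `X` lies in `Ψ(L)` and `K` is vertexwise in `^⊥L`. -/
lemma Psi.extOneVanishes [HasProducts.{max w₀ w₁} A] (hQ : IsRightRooted Q) {L : ObjectProperty A}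
    {X K : Representation Q A} (hX : Psi Q L X) (hK : ∀ i, leftPerp L (K.vertex i)) :
    ExtOneVanishes K X := by
  refine .of_forall_retraction fun E ι p w hS ↦ ?_
  obtain ⟨s, hs⟩ := hQ.wellFounded.exists_family
    (P := fun i ↦ {s : E.vertex i ⟶ X.vertex i // ι.app ((Paths.of Q).obj i) ≫ s = 𝟙 _})
    (fun i s s' ↦ ∀ j (a : i ⟶ j), s.1 ≫ X.arrow a = E.arrow a ≫ (s' j ⟨a⟩).1)
    (fun i s' ↦ by
      have hSi := Representation.shortExact_vertex hS i
      have := (hX i).1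
      obtain ⟨s, hs, hs'⟩ := ExtOneVanishes.exists_retraction_lifting hSi (psi X i)
        (hK i _ (hX i).2) (Pi.lift fun a ↦ E.arrow a.2 ≫ (s' a.1 ⟨a.2⟩).1) (by
          apply Pi.hom_ext
          intro a
          have h₁ :
              X.arrow a.2 ≫ ι.app ((Paths.of Q).obj a.1) = ι.app ((Paths.of Q).obj i) ≫ E.arrow a.2 :=
            ι.naturality _
          have h₂ := (s' a.1 ⟨a.2⟩).2
          simp [psi, ← reassoc_of% h₁, h₂])
      refine ⟨⟨s, hs⟩, fun j a ↦ ?_⟩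
      simpa [psi] using hs' =≫ Pi.π (fun a : Quiver.Star i ↦ X.vertex a.1) (.mk a))
  refine ⟨Representation.homMk (fun i ↦ (s i).1) fun a ↦ (hs _ _ a).symm, ?_⟩
  ext i
  exact (s i).2

/-- The recursion produces objects over the `M(i)`; the maps along arrows are the components of the
monomorphism in the factorization, so the condition defining `Φ(L)` holds by construction. -/
lemma IsSpecialPrecovering.phi [HasCoproducts.{max w₀ w₁} A] [EnoughInjectives A]
    (hQ : IsLeftRooted Q) {L : ObjectProperty A} [L.IsClosedUnderIsomorphisms]
    (hL : IsSpecialPrecovering L) : IsSpecialPrecovering (Phi Q L) := by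
  intro M
  obtain ⟨D, hD⟩ := hQ.wellFounded.exists_family
    (P := fun i ↦ Σ X : A, X ⟶ M.vertex i)
    (fun i d d' ↦ ∃ x : ∀ j (a : j ⟶ i), (d' j ⟨a⟩).1 ⟶ d.1,
      (∀ j a, x j a ≫ d.2 = (d' j ⟨a⟩).2 ≫ M.arrow a) ∧
      (Mono (Sigma.desc fun a : Quiver.Costar i ↦ x a.1 a.2) ∧
        L (cokernel (Sigma.desc fun a : Quiver.Costar i ↦ x a.1 a.2))) ∧
      Epi d.2 ∧ rightPerp L (kernel d.2))
    (fun i d' ↦ by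
      obtain ⟨X, g, f, hgf, hg, hf⟩ := hL.exists_factorization
        (Sigma.desc fun a : Quiver.Costar i ↦ (d' a.1 ⟨a.2⟩).2 ≫ M.arrow a.2)
      refine ⟨⟨X, f⟩, fun j a ↦ Sigma.ι (fun a : Quiver.Costar i ↦ (d' a.1 ⟨a.2⟩).1) (.mk a) ≫ g,
        fun j a ↦ ?_, ?_, hf⟩
      · simp [hgf]
      · convert hg <;> cat_disch)
  choose x hx hφ hf hker using hD
  let X : Representation Q A := Representation.mk (fun i ↦ (D i).1) fun a ↦ x _ _ a
  let f : X ⟶ M := Representation.homMk (fun i ↦ (D i).2) fun a ↦ by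
    rw [Representation.mk_arrow]
    exact hx _ _ a
  refine ⟨X, f, (NatTrans.epi_iff_epi_app f).2 hf, fun i ↦ ?_, fun Y hY ↦ ?_⟩
  -- The arrows of `X` equal the `x` only propositionally; generalizing over `φ` transports `Mono`
  -- and the cokernel together.
  · have h : ∀ φ, φ = Limits.Sigma.desc (fun a : Quiver.Costar i ↦ x i a.1 a.2) →
        Mono φ ∧ L (cokernel φ) := by
      rintro _ rfl
      exact hφ i
    exact h _ (congrArg Limits.Sigma.desc (funext fun a ↦ Representation.mk_arrow _ _ a.2))
  -- Evaluation at a vertex preserves kernels, so the kernel of `f` is vertexwise in `L^⊥`.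
  · exact hY.extOneVanishes hQ fun i ↦ (hker i).of_iso
      (PreservesKernel.iso ((evaluation (Paths Q) A).obj ((Paths.of Q).obj i)) f).symm

lemma IsSpecialPreenveloping.psi [HasProducts.{max w₀ w₁} A] [EnoughProjectives A]
    (hQ : IsRightRooted Q) {L : ObjectProperty A} [L.IsClosedUnderIsomorphisms]
    (hL : IsSpecialPreenveloping L) : IsSpecialPreenveloping (Psi Q L) := by
  intro M
  obtain ⟨D, hD⟩ := hQ.wellFounded.exists_family
    (P := fun i ↦ Σ X : A, M.vertex i ⟶ X)
    (fun i d d' ↦ ∃ x : ∀ j (a : i ⟶ j), d.1 ⟶ (d' j ⟨a⟩).1,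
      (∀ j a, M.arrow a ≫ (d' j ⟨a⟩).2 = d.2 ≫ x j a) ∧
      (Epi (Pi.lift fun a : Quiver.Star i ↦ x a.1 a.2) ∧
        L (kernel (Pi.lift fun a : Quiver.Star i ↦ x a.1 a.2))) ∧
      Mono d.2 ∧ leftPerp L (cokernel d.2))
    (fun i d' ↦ by
      obtain ⟨X, f, g, hgf, hg, hf⟩ := hL.exists_factorization
        (Pi.lift fun a : Quiver.Star i ↦ M.arrow a.2 ≫ (d' a.1 ⟨a.2⟩).2)
      refine ⟨⟨X, f⟩, fun j a ↦ g ≫ Pi.π (fun a : Quiver.Star i ↦ (d' a.1 ⟨a.2⟩).1) (.mk a),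
        fun j a ↦ ?_, ?_, hf⟩
      · simp [reassoc_of% hgf]
      · convert hg <;> cat_disch)
  choose x hx hψ hf hcoker using hD
  let X : Representation Q A := Representation.mk (fun i ↦ (D i).1) fun a ↦ x _ _ a
  let f : M ⟶ X := Representation.homMk (fun i ↦ (D i).2) fun a ↦ by
    rw [Representation.mk_arrow]
    exact hx _ _ a
  refine ⟨X, f, (NatTrans.mono_iff_mono_app f).2 hf, fun i ↦ ?_, fun Y hY ↦ ?_⟩
  · have h : ∀ ψ, ψ = Pi.lift (fun a : Quiver.Star i ↦ x i a.1 a.2) →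
        Epi ψ ∧ L (kernel ψ) := by
      rintro _ rfl
      exact hψ i
    exact h _ (congrArg Pi.lift (funext fun a ↦ Representation.mk_arrow _ _ a.2))
  · exact hY.extOneVanishes hQ fun i ↦ (hcoker i).of_iso
      (PreservesCokernel.iso ((evaluation (Paths Q) A).obj ((Paths.of Q).obj i)) f).symm

end Representations

end QuiverReps

theorem theoremB {A : Type u} [Category.{v} A] [Abelian A]
    {Q : Type w₀} [Quiver.{w₁} Q]
    (L : ObjectProperty A) [L.IsClosedUnderIsomorphisms] [L.ContainsZero]
    [L.IsClosedUnderBinaryProducts] :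
    (∀ [HasCoproducts.{max w₀ w₁} A] [AB4OfSize.{max w₀ w₁} A] [EnoughInjectives A],
      QuiverReps.IsLeftRooted Q →
      QuiverReps.IsSpecialPrecovering L →
      QuiverReps.IsSpecialPrecovering (QuiverReps.Phi Q L)) ∧
    (∀ [HasProducts.{max w₀ w₁} A] [AB4StarOfSize.{max w₀ w₁} A] [EnoughProjectives A],
      QuiverReps.IsRightRooted Q →
      QuiverReps.IsSpecialPreenveloping L →
      QuiverReps.IsSpecialPreenveloping (QuiverReps.Psi Q L)) := by
  exact ⟨fun hQ hL ↦ hL.phi hQ, fun hQ hL ↦ hL.psi hQ⟩
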